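/- Conventions. A mixed graph $G=(V,\mathcal A)$ is a finite vertex set $V$ with a set $\mathcal A$ of ordered pairs of distinct vertices (arcs); $\Gamma(G)$ is the underlying undirected graph, in which $u,v$ are adjacent if $(u,v)\in\mathcal A$ or $(v,u)\in\mathcal A$. $G$ is oriented if $(u,v)$ and $(v,u)$ are never both arcs, and bipartite if $\Gamma(G)$ is. For $\theta\in(0,\pi]$ the matrix $H_\theta(G)\in\mathbb C^{V\times V}$ has $(u,v)$-entry $1$ if both $(u,v),(v,u)\in\mathcal A$, $e^{i\theta}$ if only $(u,v)\in\mathcal A$, $e^{-i\theta}$ if only $(v,u)\in\mathcal A$, and $0$ otherwise. $G$ has the $\theta$-symmetric spectrum if the multiset of eigenvalues of $H_\theta(G)$ is invariant under $\lambda\mapsto-\lambda$. The odd circumference of $G$ is the length of a longest odd cycle of $\Gamma(G)$. For $0\le a\le t-1$ let $P_t^{(a,t-1-a)}$ be the oriented path on $p_1,\dots,p_t$ with arcs $(p_k,p_{k+1})$ for $1\le k\le a$ and $(p_{k+1},p_k)$ for $a<k\le t-1$. For $t\ge2$ and integers $s_1,\dots,s_t\ge0$ with $s_1+\dots+s_t\ge1$,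 the oriented book graph $G(s_1,\dots,s_t)$ consists of two vertices $x,y$ with the arc $(x,y)$ and, for every $1\le j\le t$ and $1\le k\le s_j$, a new vertex $z_j^{(k)}$, a copy of $P_t^{(0,t-1)}$ with $p_1=x$, $p_t=z_j^{(k)}$, and a copy of $P_t^{(j-1,t-j)}$ with $p_1=y$, $p_t=z_j^{(k)}$, the inner vertices of all these paths being new and distinct. A superscript $(r)$ on an argument means that it is repeated $r$ times. Proposition. Let $l,m$ be coprime positive integers with $m\equiv0\pmod 4$ and let $\theta=\frac lm\pi\in(0,\pi]$. Then $G\bigl(0^{(\frac m4-1)},1^{(2)}\bigr)=G(\underbrace{0,\dots,0}_{m/4-1},1,1)$ is an oriented graph, is not bipartite, has odd circumference $\frac m2+1$, and has the $\theta$-symmetric spectrum. -/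

import Mathlib

/-- A mixed graph on `V`: a set of arcs, i.e. of ordered pairs of distinct vertices. -/
structure MixedGraph (V : Type*) where
  /-- `Arc u v` means that the ordered pair `(u, v)` is an arc. -/
  Arc : V → V → Prop
  loopless : ∀ v, ¬ Arc v v

namespace MixedGraph

/-- The underlying undirected graph `Γ(G)`. -/
def underlying {V : Type*} (G : MixedGraph V) : SimpleGraph V where
  Adj u v := G.Arc u v ∨ G.Arc v u
  symm := ⟨fun _ _ h => h.symm⟩
  loopless := ⟨fun v h => h.elim (G.loopless v) (G.loopless v)⟩

/-- An oriented graph is a mixed graph without digons. -/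
def IsOriented {V : Type*} (G : MixedGraph V) : Prop :=
  ∀ u v, ¬ (G.Arc u v ∧ G.Arc v u)

/-- A mixed graph is bipartite if its underlying graph is. -/
def IsBipartite {V : Type*} (G : MixedGraph V) : Prop :=
  G.underlying.IsBipartite

/-- `n` is the odd circumference of `G`: the length of a longest odd cycle of `Γ(G)`
(in particular an odd cycle exists). -/
def IsOddCircumference {V : Type*} (G : MixedGraph V) (n : ℕ) : Prop :=
  IsGreatest {k : ℕ | Odd k ∧ ∃ (v : V) (w : G.underlying.Walk v v), w.IsCycle ∧ w.length = k} n

open Classical in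
/-- The `θ`-Hermitian adjacency matrix `H_θ(G)`. -/
noncomputable def hermitianAdj {V : Type*} (G : MixedGraph V) (θ : ℝ) : Matrix V V ℂ :=
  Matrix.of fun u v =>
    if G.Arc u v ∧ G.Arc v u then 1
    else if G.Arc u v then Complex.exp (Complex.I * (θ : ℂ))
    else if G.Arc v u then Complex.exp (-(Complex.I * (θ : ℂ)))
    else 0

/-- The `H_θ`-spectrum `Spec(G; θ)`: the multiset of eigenvalues of `H_θ(G)`. -/
noncomputable def spec {V : Type*} [Fintype V] [DecidableEq V] (G : MixedGraph V) (θ : ℝ) :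
    Multiset ℂ :=
  (G.hermitianAdj θ).charpoly.roots

/-- `G` has the `θ`-symmetric spectrum: `Spec(G; θ)` is symmetric with respect to the origin,
including multiplicities. -/
def HasSymmetricSpectrum {V : Type*} [Fintype V] [DecidableEq V] (G : MixedGraph V) (θ : ℝ) :
    Prop :=
  (G.spec θ).map (fun z => -z) = G.spec θ

/-- The oriented path `P_n^{(a, n-1-a)}` on `p_1, …, p_n` (the vertex `p_{i+1}` is `i : Fin n`):
the first `a` edges point forward, `p_k → p_{k+1}`, the remaining ones backward,
`p_{k+1} → p_k`. -/
def orientedPath (n a : ℕ) : MixedGraph (Fin n) where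
  Arc i k := (i.val + 1 = k.val ∧ i.val < a) ∨ (k.val + 1 = i.val ∧ a ≤ k.val)
  loopless := by
    intro v h
    omega

end MixedGraph

/-- The vertices of the oriented book graph `G(s_1, …, s_t)` (`s_{j+1}` is `s j`, `j : Fin t`).
There is one sheet `(j, k)` for each `j` and each `k : Fin (s j)`; the sheet has the vertex `z`,
the `t - 2` inner vertices of the path from `x` to `z` and the `t - 2` inner vertices of the path
from `y` to `z`. -/
inductive BookVertex {t : ℕ} (s : Fin t → ℕ) : Type
  | x : BookVertex s
  | y : BookVertex s
  | z (p : (j : Fin t) × Fin (s j)) : BookVertex s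
  | xInner (p : (j : Fin t) × Fin (s j)) (i : Fin (t - 2)) : BookVertex s
  | yInner (p : (j : Fin t) × Fin (s j)) (i : Fin (t - 2)) : BookVertex s
  deriving DecidableEq, Fintype

namespace BookVertex

/-- The vertices `p_1 = x, p_2, …, p_t = z` of the path from `x` to `z` in the sheet `p`
(for `t ≥ 2`). -/
def xPath {t : ℕ} {s : Fin t → ℕ} (p : (j : Fin t) × Fin (s j)) (i : Fin t) : BookVertex s :=
  if h0 : i.val = 0 then .x
  else if h1 : i.val + 1 = t then .z p
  else .xInner p ⟨i.val - 1, by omega⟩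

/-- The vertices `p_1 = y, p_2, …, p_t = z` of the path from `y` to `z` in the sheet `p`
(for `t ≥ 2`). -/
def yPath {t : ℕ} {s : Fin t → ℕ} (p : (j : Fin t) × Fin (s j)) (i : Fin t) : BookVertex s :=
  if h0 : i.val = 0 then .y
  else if h1 : i.val + 1 = t then .z p
  else .yInner p ⟨i.val - 1, by omega⟩

theorem xPath_injective {t : ℕ} {s : Fin t → ℕ} (p : (j : Fin t) × Fin (s j)) :
    Function.Injective (xPath p) := by
  intro i k h
  unfold xPath at h
  split_ifs at h <;> simp_all [Fin.ext_iff] <;> omega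

theorem yPath_injective {t : ℕ} {s : Fin t → ℕ} (p : (j : Fin t) × Fin (s j)) :
    Function.Injective (yPath p) := by
  intro i k h
  unfold yPath at h
  split_ifs at h <;> simp_all [Fin.ext_iff] <;> omega

end BookVertex

/-- The oriented book graph `G(s_1, …, s_t)` (meaningful for `t ≥ 2`): the arc from `x` to `y`
and, for each sheet `(j, k)`, a copy of `P_t^{(0, t-1)}` from `p_1 = x` to `p_t = z` and a copy of
`P_t^{(j-1, t-j)}` from `p_1 = y` to `p_t = z`; the index `p.1 : Fin t` of a sheet `p` starts at
zero, so that its value is `j - 1`. -/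
def bookGraph {t : ℕ} (s : Fin t → ℕ) : MixedGraph (BookVertex s) where
  Arc u v :=
    (u = .x ∧ v = .y) ∨
    ∃ (p : (j : Fin t) × Fin (s j)) (i k : Fin t),
      ((MixedGraph.orientedPath t 0).Arc i k ∧ u = .xPath p i ∧ v = .xPath p k) ∨
      ((MixedGraph.orientedPath t p.1.val).Arc i k ∧ u = .yPath p i ∧ v = .yPath p k)
  loopless := by
    rintro v (⟨h, h'⟩ | ⟨p, i, k, ⟨ha, h, h'⟩ | ⟨ha, h, h'⟩⟩)
    · rw [h] at h'
      cases h'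
    · have e := BookVertex.xPath_injective p (h.symm.trans h')
      subst e
      exact MixedGraph.loopless _ _ ha
    · have e := BookVertex.yPath_injective p (h.symm.trans h')
      subst e
      exact MixedGraph.loopless _ _ ha

/-! ### Spectral symmetry from switching -/

namespace MixedGraph

/-! Put t = m/4 + 1. The graph has two sheets, which differ only in the direction of the last edge
of the path from y. Let σ swap them. It suffices to find a diagonal matrix D conjugating the
transpose of the σ-permuted matrix to -H (`roots_charpoly_map_neg`). With ω = exp(2iθ) this asks for
d(u) = -ω d(v) on each arc u → v preserved by σ and d(u) = -d(v) on each reversed one. Starting from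
d(x) = 1, these rules determine d along each sheet; they agree at z exactly when ω^(2(t-1)) =
exp(imθ) = exp(ilπ) = -1, which holds because l is odd (`hasSymmetricSpectrum_of_two_sheets`).

For the odd circumference, removing the edge xy leaves a bipartite graph, so an odd cycle consists
of xy and a path from y to x. Such a path stays in one sheet, which together with x and y has 2t - 1
= m/2 + 1 vertices, and these do form a cycle (`isOddCircumference`). -/

theorem hermitianAdj_of_arc {V : Type*} {G : MixedGraph V} (hG : G.IsOriented) (θ : ℝ) {u v : V}
    (h : G.Arc u v) : G.hermitianAdj θ u v = Complex.exp (Complex.I * θ) := by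
  have h' : ¬ G.Arc v u := fun h' => hG u v ⟨h, h'⟩
  simp [hermitianAdj, h, h']

theorem hermitianAdj_of_arc_symm {V : Type*} {G : MixedGraph V} (hG : G.IsOriented) (θ : ℝ)
    {u v : V} (h : G.Arc v u) : G.hermitianAdj θ u v = Complex.exp (-(Complex.I * θ)) := by
  have h' : ¬ G.Arc u v := fun h' => hG u v ⟨h', h⟩
  simp [hermitianAdj, h, h']

theorem hermitianAdj_of_not_adj {V : Type*} {G : MixedGraph V} (θ : ℝ) {u v : V}
    (h : ¬ G.underlying.Adj u v) : G.hermitianAdj θ u v = 0 := by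
  have h1 : ¬ G.Arc u v := fun h' => h (Or.inl h')
  have h2 : ¬ G.Arc v u := fun h' => h (Or.inr h')
  simp [hermitianAdj, h1, h2]

open Polynomial in
/-- If `-A` is diagonally similar to the transpose of a symmetric permutation of `A`, then the
multiset of eigenvalues of `A` is symmetric. -/
theorem roots_charpoly_map_neg {V R : Type*} [Fintype V] [DecidableEq V] [CommRing R] [IsDomain R]
    (A : Matrix V V R) (σ : V ≃ V) (d : V → Rˣ)
    (h : ∀ u v, (d u : R) * A (σ v) (σ u) = -(A u v * d v)) :
    A.charpoly.roots.map (fun z => -z) = A.charpoly.roots := by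
  let D : (Matrix V V R)ˣ := Units.map (Matrix.diagonalRingHom V R).toMonoidHom
    (MulEquiv.piUnits.symm d)
  have hD : (D : Matrix V V R) = Matrix.diagonal fun v => (d v : R) := rfl
  have key : (D : Matrix V V R) * (Matrix.reindex σ.symm σ.symm A).transpose = -A * D := by
    ext u v
    rw [hD, Matrix.diagonal_mul, Matrix.mul_diagonal]
    simpa using h u v
  have hneg : (-A).charpoly = A.charpoly := by
    have : -A = (D : Matrix V V R) * (Matrix.reindex σ.symm σ.symm A).transpose * (D⁻¹).val := by
      rw [key, mul_assoc, Units.mul_inv, mul_one]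
    rw [this, Matrix.charpoly_mul_comm, ← mul_assoc, Units.inv_mul, one_mul,
      Matrix.charpoly_transpose, Matrix.charpoly_reindex]
  have hcomp : (-A).charpoly = C ((-1 : R) ^ Fintype.card V) * A.charpoly.comp (-X) := by
    -- X + A is the negative of X - A evaluated at -X.
    have h1 : (-A).charmatrix = -(A.charmatrix.map (Polynomial.compRingHom (-X))) := by
      ext1 u v
      by_cases huv : u = v
      · subst huv
        simp [Matrix.charmatrix_apply_eq]; ring
      · simp [Matrix.charmatrix_apply_ne _ _ _ huv]
    rw [Matrix.charpoly, h1, Matrix.det_neg, Matrix.charpoly,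
      ← Polynomial.coe_compRingHom_apply, RingHom.map_det]
    simp [RingHom.mapMatrix_apply]
  rw [← Polynomial.roots_comp_neg_X]
  conv_rhs => rw [← hneg, hcomp]
  rw [Polynomial.roots_C_mul]
  exact pow_ne_zero _ (neg_ne_zero.mpr one_ne_zero)

/-- Transposition turns an arc preserved by σ into the entry exp(-iθ), hence the factor exp(2iθ); on
a reversed arc the two effects cancel and only the sign remains. -/
theorem hasSymmetricSpectrum_of_switching {V : Type*} [Fintype V] [DecidableEq V]
    {G : MixedGraph V} (hG : G.IsOriented) (θ : ℝ) (σ : V ≃ V) (hσ : ∀ v, σ (σ v) = v)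
    (d : V → ℂˣ)
    (h : ∀ u v, G.Arc u v →
      (G.Arc (σ u) (σ v) ∧ (d u : ℂ) = -(Complex.exp (Complex.I * θ) ^ 2 * d v)) ∨
      (G.Arc (σ v) (σ u) ∧ d u = -d v)) :
    G.HasSymmetricSpectrum θ := by
  refine roots_charpoly_map_neg _ σ d fun u v => ?_
  have he : Complex.exp (Complex.I * θ) * Complex.exp (-(Complex.I * θ)) = 1 := by
    rw [← Complex.exp_add, add_neg_cancel, Complex.exp_zero]
  by_cases huv : G.Arc u v
  · rw [hermitianAdj_of_arc hG θ huv]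
    obtain ⟨h1, h2⟩ | ⟨h1, h2⟩ := h u v huv
    · rw [hermitianAdj_of_arc_symm hG θ h1, h2]
      linear_combination -(Complex.exp (Complex.I * θ) * d v) * he
    · rw [hermitianAdj_of_arc hG θ h1, h2]
      push_cast
      ring
  by_cases hvu : G.Arc v u
  · rw [hermitianAdj_of_arc_symm hG θ hvu]
    obtain ⟨h1, h2⟩ | ⟨h1, h2⟩ := h v u hvu
    · rw [hermitianAdj_of_arc hG θ h1, h2]
      linear_combination -(Complex.exp (Complex.I * θ) * d u) * he
    · rw [hermitianAdj_of_arc_symm hG θ h1, h2]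
      push_cast
      ring
  -- As σ is an involution, preserving adjacency also means preserving non-adjacency.
  have hadj : ∀ a b, G.Arc a b → G.Arc (σ a) (σ b) ∨ G.Arc (σ b) (σ a) := fun a b hab =>
    (h a b hab).imp And.left And.left
  rw [hermitianAdj_of_not_adj θ, hermitianAdj_of_not_adj θ]
  · simp
  · exact fun h' => h'.elim huv hvu
  · rintro (h' | h')
    · have := hadj _ _ h'
      simp only [hσ] at this
      tauto
    · have := hadj _ _ h'
      simp only [hσ] at this
      tauto

end MixedGraph

/-! ### Paths and sheets of a book graph -/

namespace BookVertex

variable {t : ℕ} {s : Fin t → ℕ}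

theorem xPath_zero (p : (j : Fin t) × Fin (s j)) {i : Fin t} (hi : i.val = 0) :
    xPath p i = .x := by
  simp [xPath, hi]

theorem yPath_zero (p : (j : Fin t) × Fin (s j)) {i : Fin t} (hi : i.val = 0) :
    yPath p i = .y := by
  simp [yPath, hi]

theorem xPath_eq_x_iff (p : (j : Fin t) × Fin (s j)) (i : Fin t) :
    xPath p i = .x ↔ i.val = 0 := by
  unfold xPath
  split_ifs <;> simp_all

theorem yPath_eq_y_iff (p : (j : Fin t) × Fin (s j)) (i : Fin t) :
    yPath p i = .y ↔ i.val = 0 := by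
  unfold yPath
  split_ifs <;> simp_all

theorem xPath_ne_y (p : (j : Fin t) × Fin (s j)) (i : Fin t) : xPath p i ≠ .y := by
  unfold xPath
  split_ifs <;> simp

theorem yPath_ne_x (p : (j : Fin t) × Fin (s j)) (i : Fin t) : yPath p i ≠ .x := by
  unfold yPath
  split_ifs <;> simp

theorem xPath_eq_xPath_iff (p q : (j : Fin t) × Fin (s j)) (i k : Fin t) :
    xPath p i = xPath q k ↔ i = k ∧ (i.val = 0 ∨ p = q) := by
  unfold xPath
  split_ifs <;> simp_all [Fin.ext_iff] <;> grind

theorem yPath_eq_yPath_iff (p q : (j : Fin t) × Fin (s j)) (i k : Fin t) :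
    yPath p i = yPath q k ↔ i = k ∧ (i.val = 0 ∨ p = q) := by
  unfold yPath
  split_ifs <;> simp_all [Fin.ext_iff] <;> grind

theorem xPath_eq_yPath_iff (ht : 2 ≤ t) (p q : (j : Fin t) × Fin (s j)) (i k : Fin t) :
    xPath p i = yPath q k ↔ p = q ∧ i.val + 1 = t ∧ k.val + 1 = t := by
  unfold xPath yPath
  split_ifs <;> simp_all <;> omega

/-- The permutation of the vertices of a book graph induced by a permutation of its sheets. -/
def permSheets (e : Equiv.Perm ((j : Fin t) × Fin (s j))) : BookVertex s → BookVertex s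
  | .x => .x
  | .y => .y
  | .z p => .z (e p)
  | .xInner p i => .xInner (e p) i
  | .yInner p i => .yInner (e p) i

theorem permSheets_xPath (e : Equiv.Perm ((j : Fin t) × Fin (s j)))
    (p : (j : Fin t) × Fin (s j)) (i : Fin t) :
    permSheets e (xPath p i) = xPath (e p) i := by
  unfold xPath
  split_ifs <;> rfl

theorem permSheets_yPath (e : Equiv.Perm ((j : Fin t) × Fin (s j)))
    (p : (j : Fin t) × Fin (s j)) (i : Fin t) :
    permSheets e (yPath p i) = yPath (e p) i := by
  unfold yPath
  split_ifs <;> rfl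

theorem permSheets_involutive {e : Equiv.Perm ((j : Fin t) × Fin (s j))}
    (he : Function.Involutive e) : Function.Involutive (permSheets e) := by
  rintro (_ | _ | p | ⟨p, i⟩ | ⟨p, i⟩) <;> simp [permSheets, he _]

/-- The sheet of a vertex other than `x` and `y`. -/
def sheet : BookVertex s → Option ((j : Fin t) × Fin (s j))
  | .x => none
  | .y => none
  | .z p => some p
  | .xInner p _ => some p
  | .yInner p _ => some p

theorem sheet_xPath (p : (j : Fin t) × Fin (s j)) {i : Fin t} (hi : i.val ≠ 0) :
    (xPath p i).sheet = some p := by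
  unfold xPath
  rw [dif_neg hi]
  split_ifs <;> rfl

theorem sheet_yPath (p : (j : Fin t) × Fin (s j)) {i : Fin t} (hi : i.val ≠ 0) :
    (yPath p i).sheet = some p := by
  unfold yPath
  rw [dif_neg hi]
  split_ifs <;> rfl

/-- The function on the vertices with the value `f i` at `p_{i+1}` on every path from `x`, and
the value `g i` at `p_{i+1}` on every path from `y`, except at its last vertex. -/
def pathFun {α : Type*} (f g : ℕ → α) : BookVertex s → α
  | .x => f 0
  | .y => g 0
  | .z _ => f (t - 1)
  | .xInner _ i => f (i + 1)
  | .yInner _ i => g (i + 1)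

theorem pathFun_xPath {α : Type*} (f g : ℕ → α) (p : (j : Fin t) × Fin (s j)) (i : Fin t) :
    pathFun f g (xPath p i) = f i := by
  unfold xPath
  split_ifs <;> simp only [pathFun] <;> congr 1 <;> omega

theorem pathFun_yPath_of_lt {α : Type*} (f g : ℕ → α) (p : (j : Fin t) × Fin (s j)) {i : Fin t}
    (hi : i.val + 1 < t) : pathFun f g (yPath p i) = g i := by
  unfold yPath
  split_ifs <;> simp only [pathFun] <;> congr 1 <;> omega

theorem pathFun_yPath_of_eq {α : Type*} (f g : ℕ → α) (p : (j : Fin t) × Fin (s j)) {i : Fin t}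
    (ht : 2 ≤ t) (hi : i.val + 1 = t) : pathFun f g (yPath p i) = f i := by
  unfold yPath
  split_ifs <;> simp only [pathFun] <;> congr 1 <;> omega

/-- The `2 t - 1` vertices of the cycle through `x`, `y` and the sheet `p`, in cyclic order. -/
def sheetCycle (p : (j : Fin t) × Fin (s j)) (i : Fin (2 * t - 1)) : BookVertex s :=
  if h : i.val < t then yPath p ⟨i, h⟩ else xPath p ⟨2 * t - 2 - i, by omega⟩

theorem sheetCycle_injective (ht : 2 ≤ t) (p : (j : Fin t) × Fin (s j)) :
    Function.Injective (sheetCycle p) := by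
  intro i k h
  unfold sheetCycle at h
  rw [Fin.ext_iff]
  split_ifs at h
  · simpa using (yPath_injective p h)
  · have := (xPath_eq_yPath_iff ht p p _ _).mp h.symm
    simp only at this
    omega
  · have := (xPath_eq_yPath_iff ht p p _ _).mp h
    simp only at this
    omega
  · have := xPath_injective p h
    simp only [Fin.mk.injEq] at this
    omega

theorem exists_sheetCycle_eq (ht : 2 ≤ t) (p : (j : Fin t) × Fin (s j)) (v : BookVertex s)
    (hv : v.sheet = some p ∨ v.sheet = none) : ∃ i, sheetCycle p i = v := by
  have hy : ∀ i : Fin t, ∃ k, sheetCycle p k = yPath p i := fun i =>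
    ⟨⟨i, by omega⟩, by simp [sheetCycle]⟩
  have hx : ∀ i : Fin t, ∃ k, sheetCycle p k = xPath p i := by
    intro i
    by_cases hi : i.val + 1 = t
    · rw [(xPath_eq_yPath_iff ht p p i i).mpr ⟨rfl, hi, hi⟩]
      exact hy i
    · refine ⟨⟨2 * t - 2 - i, by omega⟩, ?_⟩
      have : ¬ 2 * t - 2 - i.val < t := by omega
      simp only [sheetCycle, this, dif_neg, not_false_eq_true]
      congr 1
      ext
      simp only
      omega
  obtain _ | _ | q | ⟨q, i⟩ | ⟨q, i⟩ := v
  · rw [← xPath_zero p (i := ⟨0, by omega⟩) rfl]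
    exact hx _
  · rw [← yPath_zero p (i := ⟨0, by omega⟩) rfl]
    exact hy _
  · obtain rfl : q = p := by simpa [sheet] using hv
    convert hx ⟨t - 1, by omega⟩ using 3
    have h1 : t - 1 ≠ 0 := by omega
    have h2 : t - 1 + 1 = t := by omega
    simp [xPath, h1, h2]
  · obtain rfl : q = p := by simpa [sheet] using hv
    convert hx ⟨i + 1, by omega⟩ using 3
    have h2 : i.val + 1 + 1 ≠ t := by omega
    simp [xPath, h2]
  · obtain rfl : q = p := by simpa [sheet] using hv
    convert hy ⟨i + 1, by omega⟩ using 3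
    have h2 : i.val + 1 + 1 ≠ t := by omega
    simp [yPath, h2]

end BookVertex

/-! ### Adjacency in book graphs -/

namespace bookGraph

open BookVertex MixedGraph

variable {t : ℕ} {s : Fin t → ℕ}

theorem isOriented (ht : 2 ≤ t) (s : Fin t → ℕ) : (bookGraph s).IsOriented := by
  rintro u v ⟨⟨rfl, rfl⟩ | ⟨p, i, k, ⟨h, rfl, rfl⟩ | ⟨h, rfl, rfl⟩⟩,
    ⟨h1, h2⟩ | ⟨q, i', k', ⟨h', h1, h2⟩ | ⟨h', h1, h2⟩⟩⟩
  · cases h1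
  · exact xPath_ne_y _ _ h1.symm
  · exact yPath_ne_x _ _ h2.symm
  · exact xPath_ne_y _ _ h2
  · rw [xPath_eq_xPath_iff] at h1 h2
    simp only [orientedPath, Fin.ext_iff] at *
    omega
  · rw [xPath_eq_yPath_iff ht] at h1 h2
    simp only [orientedPath] at *
    omega
  · exact yPath_ne_x _ _ h1
  · rw [eq_comm, xPath_eq_yPath_iff ht] at h1 h2
    simp only [orientedPath] at *
    omega
  · rw [yPath_eq_yPath_iff] at h1 h2
    simp only [orientedPath, Fin.ext_iff] at *
    -- Directions on paths from y depend on the sheet, but u and v are not both y, so the sheets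
    -- agree.
    obtain ⟨h1, h1' | rfl⟩ := h1 <;> obtain ⟨h2, h2' | h2'⟩ := h2 <;>
      first | omega | (subst h2'; omega)

theorem arc_x_y : (bookGraph s).Arc .x .y := Or.inl ⟨rfl, rfl⟩

theorem arc_xPath (p : (j : Fin t) × Fin (s j)) {i k : Fin t} (h : i.val + 1 = k.val) :
    (bookGraph s).Arc (xPath p k) (xPath p i) :=
  Or.inr ⟨p, k, i, Or.inl ⟨Or.inr ⟨h, Nat.zero_le _⟩, rfl, rfl⟩⟩

theorem adj_yPath (p : (j : Fin t) × Fin (s j)) {i k : Fin t} (h : i.val + 1 = k.val) :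
    (bookGraph s).underlying.Adj (yPath p i) (yPath p k) := by
  by_cases hi : i.val < p.1.val
  · exact Or.inl (Or.inr ⟨p, i, k, Or.inr ⟨Or.inl ⟨h, hi⟩, rfl, rfl⟩⟩)
  · exact Or.inr (Or.inr ⟨p, k, i, Or.inr ⟨Or.inr ⟨h, not_lt.mp hi⟩, rfl, rfl⟩⟩)

theorem adj_cases {u v : BookVertex s} (h : (bookGraph s).underlying.Adj u v) :
    s(u, v) = s(.x, .y) ∨ ∃ (p : (j : Fin t) × Fin (s j)) (i k : Fin t), i.val + 1 = k.val ∧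
      (s(u, v) = s(xPath p i, xPath p k) ∨ s(u, v) = s(yPath p i, yPath p k)) := by
  have key : ∀ u v, (bookGraph s).Arc u v → s(u, v) = s(.x, .y) ∨
      ∃ (p : (j : Fin t) × Fin (s j)) (i k : Fin t), i.val + 1 = k.val ∧
        (s(u, v) = s(xPath p i, xPath p k) ∨ s(u, v) = s(yPath p i, yPath p k)) := by
    rintro u v (⟨rfl, rfl⟩ | ⟨p, i, k, ⟨⟨h, -⟩ | ⟨h, -⟩, rfl, rfl⟩ | ⟨⟨h, -⟩ | ⟨h, -⟩, rfl, rfl⟩⟩)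
    · exact Or.inl rfl
    · exact Or.inr ⟨p, i, k, h, Or.inl rfl⟩
    · exact Or.inr ⟨p, k, i, h, Or.inl Sym2.eq_swap⟩
    · exact Or.inr ⟨p, i, k, h, Or.inr rfl⟩
    · exact Or.inr ⟨p, k, i, h, Or.inr Sym2.eq_swap⟩
  obtain h | h := h
  · exact key u v h
  · rw [Sym2.eq_swap]
    exact key v u h
-- Odd cycles
theorem sheetCycle_adj_succ (ht : 2 ≤ t) (p : (j : Fin t) × Fin (s j)) {i k : Fin (2 * t - 1)}
    (h : i.val + 1 = k.val) :
    (bookGraph s).underlying.Adj (sheetCycle p i) (sheetCycle p k) := by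
  unfold sheetCycle
  by_cases hk : k.val < t
  · have hi : i.val < t := by omega
    rw [dif_pos hi, dif_pos hk]
    exact adj_yPath p h
  · rw [dif_neg hk]
    by_cases hi : i.val < t
    -- The turning point i = t - 1 is z, which is also the end of the path from x.
    · rw [dif_pos hi, ← (xPath_eq_yPath_iff ht p p ⟨i, hi⟩ ⟨i, hi⟩).mpr
        ⟨rfl, by simp only; omega, by simp only; omega⟩]
      exact Or.inl (arc_xPath p (by simp only; omega))
    · rw [dif_neg hi]
      exact Or.inl (arc_xPath p (by simp only; omega))

theorem sheetCycle_adj_last (ht : 2 ≤ t) (p : (j : Fin t) × Fin (s j)) {i k : Fin (2 * t - 1)}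
    (hi : i.val = 0) (hk : k.val = 2 * t - 2) :
    (bookGraph s).underlying.Adj (sheetCycle p i) (sheetCycle p k) := by
  have hi' : i.val < t := by omega
  have hk' : ¬ k.val < t := by omega
  unfold sheetCycle
  rw [dif_pos hi', dif_neg hk', yPath_zero p (by exact hi), xPath_zero p (by simp only; omega)]
  exact Or.inr arc_x_y

theorem exists_isCycle_of_sheet (ht : 2 ≤ t) (p : (j : Fin t) × Fin (s j)) :
    ∃ (v : BookVertex s) (w : (bookGraph s).underlying.Walk v v),
      w.IsCycle ∧ w.length = 2 * t - 1 := by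
  have key : ∀ i k : Fin (2 * t - 1), (i - k).val = 1 →
      (bookGraph s).underlying.Adj (sheetCycle p k) (sheetCycle p i) := by
    intro i k h
    by_cases hle : k ≤ i
    · rw [Fin.sub_val_of_le hle] at h
      exact sheetCycle_adj_succ ht p (by omega)
    -- Wrap-around: here i = 0 and k = 2t - 2, which is the edge xy.
    · rw [Fin.coe_sub_iff_lt.mpr (not_le.mp hle)] at h
      exact (sheetCycle_adj_last ht p (by omega) (by omega)).symm
  refine (SimpleGraph.cycleGraph_isContained_iff (by omega)).mp
    ⟨⟨⟨sheetCycle p, ?_⟩, sheetCycle_injective ht p⟩⟩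
  intro i k h
  obtain h | h := SimpleGraph.cycleGraph_adj'.mp h
  · exact (key _ _ h).symm
  · exact key _ _ h

/-- Without the arc from `x` to `y` the book graph is bipartite. -/
theorem even_length_of_not_mem_edges (ht : 2 ≤ t) {v : BookVertex s}
    (w : (bookGraph s).underlying.Walk v v) (hw : s(.x, .y) ∉ w.edges) : Even w.length := by
  -- Colour by parity of the position; the paths to z from x and from y have equal length, so only
  -- xy is monochromatic.
  let c : BookVertex s → Bool := pathFun (fun i => decide (Even i)) (fun i => decide (Even i))
  have hx : ∀ (p : (j : Fin t) × Fin (s j)) (i : Fin t), c (xPath p i) = decide (Even i.val) :=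
    fun p i => pathFun_xPath _ _ p i
  have hy : ∀ (p : (j : Fin t) × Fin (s j)) (i : Fin t), c (yPath p i) = decide (Even i.val) := by
    intro p i
    by_cases hi : i.val + 1 = t
    · exact pathFun_yPath_of_eq _ _ p ht hi
    · exact pathFun_yPath_of_lt _ _ p (by omega)
  have hc : ∀ {u v}, ((bookGraph s).underlying.deleteEdges {s(.x, .y)}).Adj u v → c u ≠ c v := by
    intro u v huv
    rw [SimpleGraph.deleteEdges_adj] at huv
    obtain h | ⟨p, i, k, hik, h | h⟩ := adj_cases huv.1
    · exact absurd h huv.2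
    all_goals
      rw [Sym2.eq_iff] at h
      obtain ⟨rfl, rfl⟩ | ⟨rfl, rfl⟩ := h <;> simp only [hx, hy, ← hik, Nat.even_add_one] <;>
        by_cases hi : Even i.val <;> simp [hi]
  have := (SimpleGraph.Coloring.even_length_iff_congr (SimpleGraph.Coloring.mk c hc)
    (w.toDeleteEdges {s(.x, .y)} fun e he h => hw (h ▸ he))).mpr Iff.rfl
  simpa using this

theorem sheet_eq_of_adj {u v : BookVertex s} (h : (bookGraph s).underlying.Adj u v)
    (hu : u ≠ .x ∧ u ≠ .y) (hv : v ≠ .x ∧ v ≠ .y) : u.sheet = v.sheet := by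
  obtain h | ⟨p, i, k, hik, h | h⟩ := adj_cases h
  · obtain ⟨rfl, rfl⟩ | ⟨rfl, rfl⟩ := Sym2.eq_iff.mp h
    · exact absurd rfl hu.1
    · exact absurd rfl hv.1
  · obtain ⟨rfl, rfl⟩ | ⟨rfl, rfl⟩ := Sym2.eq_iff.mp h <;>
      simp only [ne_eq, xPath_eq_x_iff] at hu hv <;>
      rw [sheet_xPath _ (by tauto), sheet_xPath _ (by tauto)]
  · obtain ⟨rfl, rfl⟩ | ⟨rfl, rfl⟩ := Sym2.eq_iff.mp h <;>
      simp only [ne_eq, yPath_eq_y_iff] at hu hv <;>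
      rw [sheet_yPath _ (by tauto), sheet_yPath _ (by tauto)]

/-- A sheet can be left only through x or y; y is avoided, and a path ending at x stops on reaching
it. -/
theorem sheet_of_mem_support_path {u : BookVertex s} (q : (bookGraph s).underlying.Walk u .x)
    (hq : q.IsPath) (hy : .y ∉ q.support) :
    ∀ v ∈ q.support, v.sheet = u.sheet ∨ v.sheet = none := by
  generalize hx : (BookVertex.x : BookVertex s) = x' at q
  induction q with
  | nil => simp
  | @cons a b c hab q ih =>
    subst hx
    rw [SimpleGraph.Walk.cons_isPath_iff] at hq
    rw [SimpleGraph.Walk.support_cons, List.mem_cons, not_or] at hy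
    intro v hv
    rw [SimpleGraph.Walk.support_cons, List.mem_cons] at hv
    obtain rfl | hv := hv
    · exact Or.inl rfl
    by_cases hb : b = .x
    · subst hb
      rw [(SimpleGraph.Walk.isPath_iff_nil.mp hq.1).eq_nil, SimpleGraph.Walk.support_nil,
        List.mem_singleton] at hv
      subst hv
      exact Or.inr rfl
    · have ha : a ≠ .x := by
        rintro rfl
        exact hq.2 q.end_mem_support
      have hby : b ≠ .y := by
        rintro rfl
        exact hy.2 q.start_mem_support
      rw [sheet_eq_of_adj hab ⟨ha, fun h => hy.1 h.symm⟩ ⟨hb, hby⟩]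
      exact ih rfl hq.1 hy.2 v hv

theorem exists_sheet_of_ne {v : BookVertex s} (hx : v ≠ .x) (hy : v ≠ .y) :
    ∃ p, v.sheet = some p := by
  cases v <;> simp_all [sheet]

/-- A path from `y` to `x` other than the edge stays in one sheet. -/
theorem length_path_le (ht : 2 ≤ t) (q : (bookGraph s).underlying.Walk .y .x)
    (hq : q.IsPath) (hxy : s(.x, .y) ∉ q.edges) : q.length ≤ 2 * t - 2 := by
  obtain ⟨p, hp⟩ : ∃ p, ∀ v ∈ q.support, v.sheet = some p ∨ v.sheet = none := by
    cases q with
    | @cons _ b _ hab q =>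
      rw [SimpleGraph.Walk.cons_isPath_iff] at hq
      rw [SimpleGraph.Walk.edges_cons, List.mem_cons, not_or] at hxy
      have hb : b ≠ .x := by
        rintro rfl
        exact hxy.1 Sym2.eq_swap
      obtain ⟨p, hp⟩ := exists_sheet_of_ne hb hab.ne'
      refine ⟨p, fun v hv => ?_⟩
      rw [SimpleGraph.Walk.support_cons, List.mem_cons] at hv
      obtain rfl | hv := hv
      · exact Or.inr rfl
      · rw [← hp]
        exact sheet_of_mem_support_path q hq.1 hq.2 v hv
  have hsub : q.support.toFinset ⊆ Finset.univ.image (sheetCycle p) := by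
    intro v hv
    obtain ⟨i, rfl⟩ := exists_sheetCycle_eq ht p v (hp v (List.mem_toFinset.mp hv))
    exact Finset.mem_image_of_mem _ (Finset.mem_univ i)
  have := (Finset.card_le_card hsub).trans Finset.card_image_le
  rw [List.toFinset_card_of_nodup hq.support_nodup, SimpleGraph.Walk.length_support,
    Finset.card_univ, Fintype.card_fin] at this
  omega

theorem length_cycle_le (ht : 2 ≤ t) {v : BookVertex s}
    (w : (bookGraph s).underlying.Walk v v) (hw : w.IsCycle) (hodd : Odd w.length) :
    w.length ≤ 2 * t - 1 := by
  have hmem : s(.x, .y) ∈ w.edges := by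
    by_contra h
    exact Nat.not_even_iff_odd.mpr hodd (even_length_of_not_mem_edges ht w h)
  have key : ∀ c : (bookGraph s).underlying.Walk .x .x, c.IsCycle → c.snd = .y →
      c.length ≤ 2 * t - 1 := by
    intro c hc hsnd
    cases c with
    | nil => simp
    | @cons _ b _ h q =>
      obtain rfl : b = .y := by simpa using hsnd
      rw [SimpleGraph.Walk.cons_isCycle_iff] at hc
      have := length_path_le ht q hc.1 hc.2
      rw [SimpleGraph.Walk.length_cons]
      omega
  have hx : .x ∈ w.support := w.fst_mem_support_of_mem_edges hmem
  let c := w.rotate .x hx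
  have hc : c.IsCycle := hw.rotate hx
  have hlen : c.length = w.length := w.length_rotate .x hx
  have hy : BookVertex.y ∈ c.toSubgraph.neighborSet .x := by
    rw [SimpleGraph.Subgraph.mem_neighborSet, ← SimpleGraph.Subgraph.mem_edgeSet,
      SimpleGraph.Walk.mem_edges_toSubgraph]
    exact (w.rotate_edges .x hx).mem_iff.mpr hmem
  rw [← hlen]
  -- On the cycle based at x, y is second or next to last; reversal reduces the latter case to the
  -- former.
  rw [hc.neighborSet_toSubgraph_endpoint] at hy
  obtain h | h := hy
  · exact key c hc h.symm
  · rw [← SimpleGraph.Walk.length_reverse]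
    exact key c.reverse hc.reverse (by rw [SimpleGraph.Walk.snd_reverse]; exact h.symm)

theorem isOddCircumference (ht : 2 ≤ t) (p : (j : Fin t) × Fin (s j)) :
    (bookGraph s).IsOddCircumference (2 * t - 1) := by
  refine ⟨⟨⟨t - 1, by omega⟩, exists_isCycle_of_sheet ht p⟩, ?_⟩
  rintro k ⟨hk, v, w, hw, rfl⟩
  exact length_cycle_le ht w hw hk

theorem not_isBipartite (ht : 2 ≤ t) (p : (j : Fin t) × Fin (s j)) :
    ¬ (bookGraph s).IsBipartite := by
  intro h
  obtain ⟨v, w, -, hw⟩ := exists_isCycle_of_sheet ht p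
  have := SimpleGraph.two_colorable_iff_forall_loop_even.mp h v w
  rw [hw, Nat.even_iff] at this
  omega
-- Symmetric spectrum of the two-sheet book
theorem hasSymmetricSpectrum_of_two_sheets (ht : 2 ≤ t) (P Q : (j : Fin t) × Fin (s j))
    (hPQ : ∀ p, p = P ∨ p = Q) (hP : P.1.val + 2 = t) (hQ : Q.1.val + 1 = t) (θ : ℝ)
    (hθ : Complex.exp (Complex.I * θ) ^ (4 * (t - 1)) = -1) :
    (bookGraph s).HasSymmetricSpectrum θ := by
  let e : Equiv.Perm ((j : Fin t) × Fin (s j)) := Equiv.swap P Q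
  have hinv : Function.Involutive (permSheets e) :=
    permSheets_involutive fun p => by simp [e, ← Equiv.Perm.mul_apply]
  let ω : ℂˣ := Units.mk0 (Complex.exp (Complex.I * θ)) (Complex.exp_ne_zero _) ^ 2
  have hω : (ω : ℂ) = Complex.exp (Complex.I * θ) ^ 2 := rfl
  have hωt : ω ^ (2 * (t - 1)) = -1 := by
    ext
    rw [Units.val_pow_eq_pow_val, hω, ← pow_mul, ← mul_assoc]
    exact hθ
  let f : ℕ → ℂˣ := fun i => (-ω) ^ i
  -- The shift by one accounts for the arc from x to y.
  let g : ℕ → ℂˣ := fun i => (-ω)⁻¹ ^ (i + 1)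
  have hf : ∀ i, f (i + 1) = -(ω * f i) := fun i => by simp [f, pow_succ, mul_comm]
  have hg : ∀ i, g i = -(ω * g (i + 1)) := fun i => by
    simp only [g]
    rw [← neg_mul, pow_succ _ (i + 1), mul_comm (-ω), mul_assoc, inv_mul_cancel, mul_one]
  -- Compatibility at z across the reversed last edge; the only use of `hθ`.
  have hfg : f (t - 1) = -g (t - 2) := by
    have h2 : t - 2 + 1 = t - 1 := by omega
    simp only [f, g, h2]
    have ha : (-ω) ^ (t - 1) * (-ω) ^ (t - 1) = -1 := by
      rw [← mul_pow, neg_mul_neg, ← sq, ← pow_mul, hωt]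
    rw [inv_pow]
    generalize (-ω) ^ (t - 1) = a at ha ⊢
    rw [← neg_one_mul, ← ha, mul_inv_cancel_right]
  refine hasSymmetricSpectrum_of_switching (isOriented ht s) θ hinv.toPerm hinv
    (pathFun f g) ?_
  rintro u v (⟨rfl, rfl⟩ | ⟨p, i, k, ⟨⟨h, ha⟩ | ⟨h, -⟩, rfl, rfl⟩ | ⟨h, rfl, rfl⟩⟩)
  · refine Or.inl ⟨arc_x_y, ?_⟩
    simp [pathFun, f, g, ← hω]
  · omega
  · refine Or.inl ⟨?_, ?_⟩
    · simp only [Function.Involutive.coe_toPerm, permSheets_xPath]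
      exact arc_xPath _ h
    · rw [pathFun_xPath, pathFun_xPath, ← h, hf, ← hω]
      rfl
  -- The two indices are t - 2 and t - 1: all edges but the last point forward in both sheets, and
  -- the last ones are opposite.
  · have hp : t ≤ p.1.val + 2 ∧ t ≤ (e p).1.val + 2 ∧ 2 * t = p.1.val + (e p).1.val + 3 := by
      obtain rfl | rfl := hPQ p
      · simp only [e, Equiv.swap_apply_left]; omega
      · simp only [e, Equiv.swap_apply_right]; omega
    simp only [Function.Involutive.coe_toPerm, permSheets_yPath]
    have hlast : ∀ a b : Fin t, a.val + 1 = b.val → b.val + 1 = t →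
        pathFun f g (yPath p b) = -pathFun f g (yPath p a) := by
      intro a b hab hb
      rw [pathFun_yPath_of_eq f g p ht hb, pathFun_yPath_of_lt f g p (by omega),
        show b.val = t - 1 by omega, show a.val = t - 2 by omega, hfg]
    obtain ⟨hik, hi⟩ | ⟨hki, hk⟩ := h
    · by_cases hkt : k.val + 1 = t
      · refine Or.inr ⟨Or.inr ⟨e p, k, i, Or.inr ⟨Or.inr ⟨hik, by omega⟩, rfl, rfl⟩⟩, ?_⟩
        rw [hlast i k hik hkt, neg_neg]
      · refine Or.inl ⟨Or.inr ⟨e p, i, k, Or.inr ⟨Or.inl ⟨hik, by omega⟩, rfl, rfl⟩⟩, ?_⟩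
        rw [pathFun_yPath_of_lt f g p (by omega), pathFun_yPath_of_lt f g p (by omega), ← hik, hg,
          ← hω]
        rfl
    · refine Or.inr ⟨Or.inr ⟨e p, k, i, Or.inr ⟨Or.inl ⟨hki, by omega⟩, rfl, rfl⟩⟩, ?_⟩
      exact hlast k i hki (by omega)

end bookGraph

/-! ### The proposition -/

theorem propositionm0 (l m : ℕ) (hm : 0 < m) (hlm : Nat.Coprime l m)
    (θ : ℝ) (hθ : θ = (l : ℝ) / (m : ℝ) * Real.pi) (hθ' : θ ∈ Set.Ioc 0 Real.pi)
    (hm4 : m ≡ 0 [MOD 4]) :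
    let G := bookGraph (Fin.append (fun _ : Fin (m / 4 - 1) => 0) (fun _ : Fin 2 => 1))
    G.IsOriented ∧ ¬ G.IsBipartite ∧ G.IsOddCircumference (m / 2 + 1) ∧
      G.HasSymmetricSpectrum θ := by
  intro G
  obtain ⟨n, rfl⟩ : 4 ∣ m := (Nat.modEq_zero_iff_dvd).mp hm4
  have hn : 4 * n / 4 = n := by omega
  have hl : Odd l := by
    rw [← Nat.coprime_two_right]
    exact hlm.coprime_dvd_right ⟨2 * n, by ring⟩
  let s : Fin (4 * n / 4 - 1 + 2) → ℕ :=
    Fin.append (fun _ : Fin (4 * n / 4 - 1) => 0) (fun _ : Fin 2 => 1)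
  have hs : ∀ i : Fin 2, s (Fin.natAdd _ i) = 1 := fun i => Fin.append_right _ _ i
  let S : Fin 2 → (j : Fin (4 * n / 4 - 1 + 2)) × Fin (s j) := fun i =>
    ⟨Fin.natAdd _ i, ⟨0, by rw [hs]; exact one_pos⟩⟩
  have hS : ∀ p, p = S 0 ∨ p = S 1 := by
    rintro ⟨j, k⟩
    induction j using Fin.addCases with
    | left j =>
      have : s (Fin.castAdd 2 j) = 0 := Fin.append_left _ _ j
      exact absurd k.isLt (by omega)
    | right i =>
      have hk : k = ⟨0, by rw [hs]; exact one_pos⟩ := by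
        have := k.isLt.trans_eq (hs i)
        ext
        simp only
        omega
      subst hk
      fin_cases i
      · exact Or.inl rfl
      · exact Or.inr rfl
  have ht : 2 ≤ 4 * n / 4 - 1 + 2 := by omega
  refine ⟨bookGraph.isOriented ht s, bookGraph.not_isBipartite ht (S 0), ?_, ?_⟩
  · convert bookGraph.isOddCircumference ht (S 0) using 1
    omega
  · refine bookGraph.hasSymmetricSpectrum_of_two_sheets ht (S 0) (S 1) hS ?_ ?_ θ ?_
    · simp [S]
    · simp [S]
    -- The truncated subtraction is harmless because n > 0.
    · have hexp : 4 * (4 * n / 4 - 1 + 2 - 1) = 4 * n := by omega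
      have hn0 : (n : ℂ) ≠ 0 := by
        have : n ≠ 0 := by omega
        exact_mod_cast this
      rw [hexp, ← Complex.exp_nat_mul, hθ]
      have : ((4 * n : ℕ) : ℂ) * (Complex.I * ((l / (4 * n : ℕ) * Real.pi : ℝ) : ℂ)) =
          l * (Real.pi * Complex.I) := by
        push_cast
        field_simp
      rw [this, Complex.exp_nat_mul, Complex.exp_pi_mul_I, hl.neg_one_pow]
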